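/- For $\alpha,\beta>0$ let $X_{\alpha,\beta}$ be a Gamma random variable with shape parameter $\alpha$ and scale parameter $\beta$, i.e. with density $$f_{\alpha,\beta}(x)=\frac{x^{\alpha-1}e^{-x/\beta}}{\Gamma(\alpha)\beta^{\alpha}},\qquad x>0,$$ and let $Z$ be a standard normal random variable. Then, for all $\alpha,\beta>0$, $$P\{|X_{\alpha,\beta}-E[X_{\alpha,\beta}]|\le\sqrt{\mathrm{Var}(X_{\alpha,\beta})}\}>P\{|Z|\le 1\},$$ where $0.6826<P\{|Z|\le 1\}<0.6827$, and $$\inf_{\alpha,\beta>0}P\{|X_{\alpha,\beta}-E[X_{\alpha,\beta}]|\le\sqrt{\mathrm{Var}(X_{\alpha,\beta})}\}=P\{|Z|\le 1\}.$$ -/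

import Mathlib

open MeasureTheory ProbabilityTheory

/-! The scale cancels on standardizing. For shape `a ≥ 1`, Stirling's formula with remainder `R(a)`
gives the probability as `(2π)^(-1/2) * exp (-R(a))` times the integral over `[0, 1]` of `g(y) +
g(-y)`, where `g` is `gammaProfile a`.

By AM-GM this sum is at least `2 * √(g(y) * g(-y))`; the product loses its exponentials and becomes
`(1 - y²/a)^(a-1)`, which exceeds the Gaussian by a correction of order `1/a`
(`two_mul_exp_le_gammaProfile_add`). Since `R(a) ≤ 1/(12a)` and `exp x ≥ 1 + x`, strictness reduces
to the positivity of one explicit integral, independent of `a`.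

For `a < 1` the interval reaches below zero, so only the right tail is lost, and a crude bound of
`5/16` on it suffices. Sharpness comes from integer shapes `n → ∞`, where the probability is at most
`exp (4/√n)` times the Gaussian one. -/

/-- The integral against a gamma law, as an integral over the positive half-line. -/
lemma integral_gammaMeasure {a r : ℝ} (ha : 0 < a) (hr : 0 < r) (f : ℝ → ℝ) :
    ∫ x, f x ∂(gammaMeasure a r) =
      ∫ x in Set.Ioi (0 : ℝ),
        r ^ a / Real.Gamma a * x ^ (a - 1) * Real.exp (-(r * x)) * f x := by
  have hm : Measurable (gammaPDF a r) := (measurable_gammaPDFReal a r).ennreal_ofReal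
  rw [gammaMeasure, integral_withDensity_eq_integral_toReal_smul hm
    (ae_of_all _ fun x => ENNReal.ofReal_lt_top)]
  have h0 : ∀ x, (gammaPDF a r x).toReal • f x = gammaPDFReal a r x * f x := fun x => by
    rw [gammaPDF, ENNReal.toReal_ofReal (gammaPDFReal_nonneg ha hr x), smul_eq_mul]
  simp_rw [h0]
  rw [← integral_Ici_eq_integral_Ioi, ← integral_indicator measurableSet_Ici]
  refine integral_congr_ae (ae_of_all _ fun x => ?_)
  by_cases hx : 0 ≤ x
  · simp [gammaPDFReal, hx]
  · simp [gammaPDFReal, hx]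

/-! ### Moments and the one-sigma event of the gamma law -/

/-- The moments of the gamma law. -/
lemma integral_pow_gammaMeasure {a r : ℝ} (ha : 0 < a) (hr : 0 < r) (k : ℕ) :
    ∫ x, x ^ k ∂(gammaMeasure a r) = Real.Gamma (a + k) / (Real.Gamma a * r ^ k) := by
  rw [integral_gammaMeasure ha hr]
  have h : ∀ x ∈ Set.Ioi (0 : ℝ),
      r ^ a / Real.Gamma a * x ^ (a - 1) * Real.exp (-(r * x)) * x ^ k =
        r ^ a / Real.Gamma a * (x ^ (a + k - 1) * Real.exp (-(r * x))) := by
    intro x hx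
    rw [show a + k - 1 = (a - 1) + k by ring, Real.rpow_add_natCast (ne_of_gt hx)]
    ring
  rw [setIntegral_congr_fun measurableSet_Ioi h, integral_const_mul,
    Real.integral_rpow_mul_exp_neg_mul_Ioi (by positivity) hr, one_div,
    Real.inv_rpow hr.le, Real.rpow_add_natCast hr.ne']
  have := (Real.Gamma_pos_of_pos ha).ne'
  have := (Real.rpow_pos_of_pos hr a).ne'
  field_simp

/-- A non-integrable function would have integral `0` by convention, but the moment formula gives a
positive value. -/
lemma integrable_pow_gammaMeasure {a r : ℝ} (ha : 0 < a) (hr : 0 < r) (k : ℕ) :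
    Integrable (fun x => x ^ k) (gammaMeasure a r) := by
  by_contra h
  have h1 := integral_pow_gammaMeasure ha hr k
  rw [integral_undef h] at h1
  have := Real.Gamma_pos_of_pos ha
  have := Real.Gamma_pos_of_pos (show 0 < a + k by positivity)
  have : 0 < Real.Gamma (a + k) / (Real.Gamma a * r ^ k) := by positivity
  exact this.ne h1

lemma integral_id_gammaMeasure {a r : ℝ} (ha : 0 < a) (hr : 0 < r) :
    ∫ x, x ∂(gammaMeasure a r) = a / r := by
  have h := integral_pow_gammaMeasure ha hr 1
  simp only [pow_one, Nat.cast_one] at h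
  rw [h, Real.Gamma_add_one ha.ne']
  have := (Real.Gamma_pos_of_pos ha).ne'
  field_simp

lemma variance_id_gammaMeasure {a r : ℝ} (ha : 0 < a) (hr : 0 < r) :
    variance id (gammaMeasure a r) = a / r ^ 2 := by
  have := isProbabilityMeasure_gammaMeasure ha hr
  have hL : MemLp (id : ℝ → ℝ) 2 (gammaMeasure a r) :=
    (memLp_two_iff_integrable_sq aestronglyMeasurable_id).2 (integrable_pow_gammaMeasure ha hr 2)
  rw [variance_eq_sub hL]
  have h2 := integral_pow_gammaMeasure ha hr 2
  have hG : Real.Gamma (a + (2 : ℕ)) = (a + 1) * (a * Real.Gamma a) := by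
    rw [← Real.Gamma_add_one ha.ne', ← Real.Gamma_add_one (by positivity)]
    congr 1; push_cast; ring
  rw [hG] at h2
  simp only [Pi.pow_apply, id_eq]
  rw [h2, integral_id_gammaMeasure ha hr]
  have := (Real.Gamma_pos_of_pos ha).ne'
  field_simp
  ring

/-- The probability that a gamma variable is within one standard deviation of its mean. -/
noncomputable def gammaOneSigma (a b : ℝ) : ℝ :=
  (gammaMeasure a b⁻¹).real (Set.Icc (b * (a - √a)) (b * (a + √a)))

lemma ProbabilityTheory.HasLaw.real_abs_sub_mean_le_sqrt_variance {Ω : Type*} [MeasurableSpace Ω] {P : Measure Ω}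
    {X : Ω → ℝ} {a b : ℝ} (ha : 0 < a) (hb : 0 < b) (hX : HasLaw X (gammaMeasure a b⁻¹) P) :
    P.real {ω | |X ω - ∫ ω', X ω' ∂P| ≤ √(variance X P)} = gammaOneSigma a b := by
  have hr : 0 < b⁻¹ := inv_pos.2 hb
  rw [hX.integral_eq, hX.variance_eq, integral_id_gammaMeasure ha hr,
    variance_id_gammaMeasure ha hr]
  have h1 : √(a / b⁻¹ ^ 2) = b * √a := by
    rw [show a / b⁻¹ ^ 2 = b ^ 2 * a by field_simp, Real.sqrt_mul (by positivity),
      Real.sqrt_sq hb.le]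
  have h2 : {x : ℝ | |x - a / b⁻¹| ≤ √(a / b⁻¹ ^ 2)} =
      Set.Icc (b * (a - √a)) (b * (a + √a)) := by
    ext x
    rw [h1, Set.mem_ofPred_eq, abs_le, Set.mem_Icc, div_inv_eq_mul]
    constructor <;> rintro ⟨h, h'⟩ <;> constructor <;> linarith
  rw [hX.measureReal_eq (p := fun x => |x - a / b⁻¹| ≤ √(a / b⁻¹ ^ 2)), h2, gammaOneSigma]
  rw [h2]; exact measurableSet_Icc

lemma gammaMeasure_real_apply {a r : ℝ} (ha : 0 < a) (hr : 0 < r) {s : Set ℝ}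
    (hs : MeasurableSet s) :
    (gammaMeasure a r).real s = ∫ x in s, gammaPDFReal a r x := by
  rw [gammaMeasure, measureReal_def, withDensity_apply _ hs]
  refine (integral_eq_lintegral_of_nonneg_ae ?_ ?_).symm
  · exact ae_of_all _ fun b ↦ by simp [gammaPDFReal_nonneg ha hr]
  · fun_prop

lemma integral_symm_interval {f : ℝ → ℝ} (hf : Continuous f) (c : ℝ) :
    ∫ y in (-c)..c, f y = ∫ y in (0 : ℝ)..c, (f y + f (-y)) := by
  rw [intervalIntegral.integral_add (hf.intervalIntegrable _ _)
      (Continuous.intervalIntegrable (by fun_prop) _ _),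
    intervalIntegral.integral_comp_neg, neg_zero, add_comm,
    intervalIntegral.integral_add_adjacent_intervals (hf.intervalIntegrable _ _)
      (hf.intervalIntegrable _ _)]

/-- The probability that a standard normal variable is within one standard deviation. -/
lemma gaussianReal_real_abs_le_one :
    (gaussianReal 0 1).real {x | |x| ≤ 1} =
      (√(2 * Real.pi))⁻¹ * (2 * ∫ y in (0 : ℝ)..1, Real.exp (-y ^ 2 / 2)) := by
  have hs : {x : ℝ | |x| ≤ 1} = Set.Icc (-1) 1 := by ext x; simp [abs_le]
  rw [hs, measureReal_def, gaussianReal_apply_eq_integral _ one_ne_zero,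
    ENNReal.toReal_ofReal (integral_nonneg fun x => gaussianPDFReal_nonneg _ _ _),
    integral_Icc_eq_integral_Ioc, ← intervalIntegral.integral_of_le (by norm_num)]
  have hc : Continuous (fun y : ℝ => Real.exp (-y ^ 2 / 2)) := by fun_prop
  simp only [gaussianPDFReal_def, sub_zero, NNReal.coe_one, mul_one]
  rw [intervalIntegral.integral_const_mul, integral_symm_interval hc]
  congr 1
  rw [← intervalIntegral.integral_const_mul]
  congr 1
  ext y
  rw [neg_sq]; ring

/-! ### Stirling's formula for the real Gamma function -/

/-- The error term in Stirling's formula for `log Γ`. -/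
noncomputable def stirlingRemainder (a : ℝ) : ℝ :=
  Real.log (Real.Gamma a) - ((a - 1 / 2) * Real.log a - a + Real.log (2 * Real.pi) / 2)

/-- Expand the logarithm in odd powers of `q = 1/(2a+1)`. The leading term contributes exactly `1`;
replacing each later `1/(2k+3)` by `1/3` leaves a geometric series with sum `q²/(3(1-q²)) =
1/(12a(a+1))`, which telescopes. -/
lemma log_one_add_inv_le {a : ℝ} (ha : 0 < a) :
    (a + 1 / 2) * Real.log (1 + a⁻¹) - 1 ≤ 1 / (12 * a) - 1 / (12 * (a + 1)) := by
  have h := (Real.hasSum_log_one_add_inv ha).mul_left (a + 1 / 2)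
  set q : ℝ := 1 / (2 * a + 1) with hq
  have hq0 : 0 < q := by positivity
  have hq1 : q < 1 := by rw [hq, div_lt_one (by positivity)]; linarith
  have hqa : (a + 1 / 2) = 1 / (2 * q) := by rw [hq]; field_simp
  have hq2 : q ^ 2 < 1 := by nlinarith
  have hg := ((hasSum_geometric_of_lt_one (by positivity) hq2).mul_left (1 / 3 : ℝ)).mul_left (q ^ 2)
  rw [← hasSum_nat_add_iff' 1] at h
  have hle := hasSum_le (fun k => ?_) h hg
  · simp only [Finset.range_one, Finset.sum_singleton] at hle
    have e1 : (a + 1 / 2) * (2 * (1 / (2 * ((0 : ℕ) : ℝ) + 1)) * q ^ (2 * 0 + 1)) = 1 := by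
      rw [hqa]; push_cast; field_simp; norm_num
    rw [e1] at hle
    refine hle.trans (le_of_eq ?_)
    have : (1 - q ^ 2) = 4 * a * (a + 1) / (2 * a + 1) ^ 2 := by rw [hq]; field_simp; ring
    rw [this, hq]
    field_simp
    ring
  · have e : (a + 1 / 2) * (2 * (1 / (2 * ((k + 1 : ℕ) : ℝ) + 1)) * q ^ (2 * (k + 1) + 1)) =
        q ^ 2 * (1 / (2 * (k : ℝ) + 3) * (q ^ 2) ^ k) := by
      rw [hqa]; push_cast
      have : (2 * ((k : ℝ) + 1) + 1) ≠ 0 := by positivity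
      have : (2 * (k : ℝ) + 3) ≠ 0 := by positivity
      field_simp
      ring
    rw [e]
    gcongr
    have : (0 : ℝ) ≤ k := by positivity
    linarith

lemma stirlingRemainder_sub_le {a : ℝ} (ha : 0 < a) :
    stirlingRemainder a - 1 / (12 * a) ≤
      stirlingRemainder (a + 1) - 1 / (12 * (a + 1)) := by
  have h := log_one_add_inv_le ha
  have h1 : Real.log (1 + a⁻¹) = Real.log (a + 1) - Real.log a := by
    rw [← Real.log_div (by positivity) ha.ne']; congr 1; field_simp
  have h2 : Real.log (Real.Gamma (a + 1)) = Real.log a + Real.log (Real.Gamma a) := by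
    rw [Real.Gamma_add_one ha.ne', Real.log_mul ha.ne' (Real.Gamma_pos_of_pos ha).ne']
  rw [stirlingRemainder, stirlingRemainder, h2]
  rw [h1] at h
  linarith

lemma stirlingRemainder_sub_le_add_nat {a : ℝ} (ha : 0 < a) (n : ℕ) :
    stirlingRemainder a - 1 / (12 * a) ≤
      stirlingRemainder (a + n) - 1 / (12 * (a + n)) := by
  induction n with
  | zero => simp
  | succ n ih =>
    refine ih.trans ((stirlingRemainder_sub_le (by positivity)).trans (le_of_eq ?_))
    push_cast; rw [add_assoc]

/-- Every term on the right tends to `0` as `n → ∞`: the error in the Gauss limit for `log Γ`, the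
error in Stirling's formula for `n!`, and the loss from `log t ≥ 1 - 1/t` at `t = (n+x+1)/n`. -/
lemma stirlingRemainder_add_nat_le {x : ℝ} (hx : 0 < x) {n : ℕ} (hn : n ≠ 0) :
    stirlingRemainder (x + (n + 1 : ℕ)) ≤
      (Real.log (Real.Gamma x) - Real.BohrMollerup.logGammaSeq x n) +
      (Real.log (Stirling.stirlingSeq n) - Real.log √Real.pi) +
      (x + 1) / 2 / (n + x + 1) := by
  have hn' : (0 : ℝ) < n := by positivity
  have h1 := Real.BohrMollerup.f_add_nat_eq (f := Real.log ∘ Real.Gamma) (fun {y} hy => by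
    simp only [Function.comp]
    rw [Real.Gamma_add_one hy.ne', Real.log_mul hy.ne' (Real.Gamma_pos_of_pos hy).ne', add_comm])
    hx (n + 1)
  simp only [Function.comp] at h1
  have h2 := Stirling.log_stirlingSeq_formula n
  have h3 : Real.log √Real.pi = Real.log Real.pi / 2 := Real.log_sqrt Real.pi_pos.le
  have h4 : Real.log (2 * Real.pi) = Real.log 2 + Real.log Real.pi :=
    Real.log_mul two_ne_zero Real.pi_ne_zero
  have h5 : Real.log (2 * n) = Real.log 2 + Real.log n := Real.log_mul two_ne_zero hn'.ne'
  have h6 : Real.log (n / Real.exp 1) = Real.log n - 1 := by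
    rw [Real.log_div hn'.ne' (Real.exp_pos 1).ne', Real.log_exp]
  have h7 : (x + 1) / (n + x + 1) ≤ Real.log (n + x + 1) - Real.log n := by
    rw [← Real.log_div (by positivity) hn'.ne']
    refine le_trans (le_of_eq ?_) (Real.one_sub_inv_le_log_of_pos (by positivity))
    field_simp; ring
  have h8 := mul_le_mul_of_nonneg_left h7 (show 0 ≤ x + n + 1 / 2 by positivity)
  have h9 : (x + n + 1 / 2) * ((x + 1) / (n + x + 1)) = (x + 1) - (x + 1) / 2 / (n + x + 1) := by
    field_simp; ring
  rw [h9] at h8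
  rw [stirlingRemainder, h1, Real.BohrMollerup.logGammaSeq, h3, h4, h2, h5, h6]
  push_cast
  rw [show x + ((n : ℝ) + 1) = n + x + 1 by ring]
  linarith

/-- Stirling's upper bound for the real Gamma function. -/
lemma stirlingRemainder_le {a : ℝ} (ha : 0 < a) : stirlingRemainder a ≤ 1 / (12 * a) := by
  have t1 := (Real.BohrMollerup.tendsto_log_gamma ha).const_sub (Real.log (Real.Gamma a))
  have t2 := (Stirling.tendsto_stirlingSeq_sqrt_pi.log
    (Real.sqrt_pos.2 Real.pi_pos).ne').sub_const (Real.log √Real.pi)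
  have t3 : Filter.Tendsto (fun n : ℕ => (a + 1) / 2 / (n + a + 1)) Filter.atTop (nhds 0) := by
    apply Filter.Tendsto.const_div_atTop
    have := tendsto_natCast_atTop_atTop (R := ℝ)
    exact Filter.tendsto_atTop_add_const_right _ _ (Filter.tendsto_atTop_add_const_right _ _ this)
  have t := (t1.add t2).add t3
  simp only [sub_self, add_zero] at t
  -- The left side does not decrease under integer shifts of `a`, and the shifted values are bounded
  -- above by a null sequence.
  have : stirlingRemainder a - 1 / (12 * a) ≤ 0 := by
    refine ge_of_tendsto t ?_
    filter_upwards [Filter.eventually_ne_atTop 0] with n hn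
    refine le_trans ?_ (stirlingRemainder_add_nat_le ha hn)
    refine (stirlingRemainder_sub_le_add_nat ha (n + 1)).trans ?_
    have : 0 ≤ 1 / (12 * (a + (n + 1 : ℕ))) := by positivity
    linarith
  linarith

lemma stirlingRemainder_natCast_nonneg {n : ℕ} (hn : n ≠ 0) : 0 ≤ stirlingRemainder n := by
  have h := Stirling.le_log_factorial_stirling hn
  have hn' : (0 : ℝ) < n := by positivity
  have h2 := Real.Gamma_nat_eq_factorial n
  rw [Real.Gamma_add_one hn'.ne'] at h2
  have h3 := Real.log_mul hn'.ne' (Real.Gamma_pos_of_pos hn').ne'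
  rw [h2] at h3
  rw [stirlingRemainder]
  linarith

/-- The Gamma function in terms of its Stirling approximation. -/
lemma Gamma_eq_stirling {a : ℝ} (ha : 0 < a) :
    Real.Gamma a = √(2 * Real.pi) * a ^ (a - 1 / 2) * Real.exp (-a) *
      Real.exp (stirlingRemainder a) := by
  have hp : 0 < 2 * Real.pi := by positivity
  rw [Real.rpow_def_of_pos ha, ← Real.exp_log (Real.sqrt_pos.2 hp), Real.log_sqrt hp.le,
    ← Real.exp_add, ← Real.exp_add, ← Real.exp_add, ← Real.exp_log (Real.Gamma_pos_of_pos ha)]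
  congr 1
  rw [stirlingRemainder]
  ring

/-! ### The standardized gamma density for shape at least one -/

/-- The density at `y`, up to a constant, of a standardized gamma variable of shape `a`. -/
noncomputable def gammaProfile (a y : ℝ) : ℝ :=
  (1 + (√a)⁻¹ * y) ^ (a - 1) * Real.exp (-(√a * y))

lemma continuous_gammaProfile {a : ℝ} (ha : 1 ≤ a) : Continuous (gammaProfile a) := by
  unfold gammaProfile
  refine Continuous.mul (Continuous.rpow_const (by fun_prop) fun _ => Or.inr (by linarith))
    (by fun_prop)

lemma one_add_inv_sqrt_mul_nonneg {a y : ℝ} (ha : 1 ≤ a) (hy : -1 ≤ y) :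
    0 ≤ 1 + (√a)⁻¹ * y := by
  have h0 : 1 ≤ √a := Real.one_le_sqrt.2 ha
  have h1 : (√a)⁻¹ ≤ 1 := inv_le_one_of_one_le₀ h0
  have h2 : 0 ≤ (√a)⁻¹ := by positivity
  nlinarith

lemma sqrt_mul_gammaPDFReal {a b y : ℝ} (ha : 1 ≤ a) (hb : 0 < b) (hy : -1 ≤ y) :
    b * √a * gammaPDFReal a b⁻¹ (b * √a * y + b * a) =
      (√(2 * Real.pi))⁻¹ * Real.exp (-stirlingRemainder a) * gammaProfile a y := by
  have ha0 : 0 < a := by linarith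
  have hs : 0 < √a := Real.sqrt_pos.2 ha0
  have hs2 : √a * √a = a := Real.mul_self_sqrt ha0.le
  have h1 := one_add_inv_sqrt_mul_nonneg ha hy
  have hx : b * √a * y + b * a = b * a * (1 + (√a)⁻¹ * y) := by
    field_simp; linear_combination y * hs2
  have hx0 : 0 ≤ b * a * (1 + (√a)⁻¹ * y) := by positivity
  have hr : b⁻¹ * (b * √a * y + b * a) = a + √a * y := by field_simp; ring
  rw [gammaPDFReal, hr, hx, if_pos hx0, Real.mul_rpow (by positivity) h1,
    Real.mul_rpow hb.le ha0.le, Gamma_eq_stirling ha0, gammaProfile, Real.inv_rpow hb.le,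
    Real.rpow_sub_one hb.ne', neg_add, Real.exp_add, Real.exp_neg (stirlingRemainder a),
    show a ^ (a - 1) = a ^ (a - 1 / 2) / √a by
      rw [Real.sqrt_eq_rpow, ← Real.rpow_sub ha0]; congr 1; ring]
  have e1 := (Real.rpow_pos_of_pos hb a).ne'
  have e2 := (Real.rpow_pos_of_pos ha0 (a - 1 / 2)).ne'
  have e3 : √(2 * Real.pi) ≠ 0 := by positivity
  generalize (1 + (√a)⁻¹ * y) ^ (a - 1) = w
  field_simp

lemma gammaOneSigma_eq_integral {a b : ℝ} (ha : 1 ≤ a) (hb : 0 < b) :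
    gammaOneSigma a b = (√(2 * Real.pi))⁻¹ * Real.exp (-stirlingRemainder a) *
      ∫ y in (0 : ℝ)..1, (gammaProfile a y + gammaProfile a (-y)) := by
  have ha0 : 0 < a := by linarith
  have hs : 0 < √a := Real.sqrt_pos.2 ha0
  have hc := continuous_gammaProfile ha
  rw [gammaOneSigma, gammaMeasure_real_apply ha0 (inv_pos.2 hb) measurableSet_Icc,
    integral_Icc_eq_integral_Ioc, ← intervalIntegral.integral_of_le
      (mul_le_mul_of_nonneg_left (by linarith) hb.le),
    ← integral_symm_interval hc, ← intervalIntegral.integral_const_mul]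
  have h := intervalIntegral.smul_integral_comp_mul_add (a := -1) (b := 1)
    (gammaPDFReal a b⁻¹) (b * √a) (b * a)
  rw [show b * √a * -1 + b * a = b * (a - √a) by ring,
    show b * √a * 1 + b * a = b * (a + √a) by ring] at h
  rw [← h, smul_eq_mul, ← intervalIntegral.integral_const_mul]
  refine intervalIntegral.integral_congr fun y hy => ?_
  rw [Set.uIcc_of_le (by norm_num)] at hy
  exact sqrt_mul_gammaPDFReal ha hb hy.1

/-- This is `u ≤ sinh u` at `u = log t`. -/
lemma Real.log_le_half_sub_inv {t : ℝ} (ht : 1 ≤ t) : Real.log t ≤ (t - t⁻¹) / 2 := by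
  have h := Real.self_le_sinh_iff.2 (Real.log_nonneg ht)
  rwa [Real.sinh_eq, Real.exp_neg, Real.exp_log (by linarith)] at h

lemma exp_le_one_sub_sq_div_rpow {a y : ℝ} (ha : 1 ≤ a) (hy : y ^ 2 ≤ 1) :
    Real.exp (2 * (-y ^ 2 / 2 + (y ^ 2 / 2 - y ^ 4 / 4) / a)) ≤ (1 - y ^ 2 / a) ^ (a - 1) := by
  -- For `a = 1` the base `1 - y²/a` may vanish, so logarithms are not available.
  rcases ha.eq_or_lt with rfl | ha1
  · simp only [sub_self, Real.rpow_zero, div_one]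
    rw [Real.exp_le_one_iff]
    nlinarith [sq_nonneg (y ^ 2)]
  have ha0 : 0 < a := by linarith
  obtain ⟨x, hx⟩ : ∃ x, x = y ^ 2 / a := ⟨_, rfl⟩
  have hy2 : y ^ 2 = a * x := by rw [hx]; field_simp
  have hx0 : 0 ≤ x := by rw [hx]; positivity
  have hax : a * x ≤ 1 := hy2 ▸ hy
  have hx1 : 0 < 1 - x := by nlinarith
  rw [← hx, Real.rpow_def_of_pos hx1, Real.exp_le_exp, show y ^ 4 = (y ^ 2) ^ 2 by ring, hy2]
  have h := Real.log_le_half_sub_inv (t := (1 - x)⁻¹) (by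
    rw [one_le_inv₀ hx1]; linarith)
  rw [Real.log_inv, inv_inv] at h
  have h1 : (1 - x) * (-Real.log (1 - x) - x) ≤ x ^ 2 / 2 := by
    have := mul_le_mul_of_nonneg_left h hx1.le
    have e : (1 - x) * (((1 - x)⁻¹ - (1 - x)) / 2) = (1 - (1 - x) ^ 2) / 2 := by
      field_simp
    rw [e] at this
    nlinarith
  have h2 : 0 ≤ -Real.log (1 - x) - x := by
    have := Real.log_le_sub_one_of_pos hx1; linarith
  -- Here `a - 1 ≤ a * (1 - x)`, because `a * x = y² ≤ 1`.
  have h3 : (a - 1) * (-Real.log (1 - x) - x) ≤ a * (x ^ 2 / 2) := by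
    refine le_trans ?_ (mul_le_mul_of_nonneg_left h1 ha0.le)
    rw [← mul_assoc]
    exact mul_le_mul_of_nonneg_right (by linarith) h2
  have e : (a * x / 2 - (a * x) ^ 2 / 4) / a = x / 2 - a * x ^ 2 / 4 := by field_simp
  rw [e]
  linarith

/-- AM-GM for the values at `y` and `-y`: in their product the factors `exp (∓√a * y)` cancel. -/
lemma two_mul_exp_le_gammaProfile_add {a y : ℝ} (ha : 1 ≤ a) (hy : y ∈ Set.Icc (-1 : ℝ) 1) :
    2 * Real.exp (-y ^ 2 / 2 + (y ^ 2 / 2 - y ^ 4 / 4) / a) ≤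
      gammaProfile a y + gammaProfile a (-y) := by
  have h1 := one_add_inv_sqrt_mul_nonneg ha hy.1
  have h2 := one_add_inv_sqrt_mul_nonneg ha (neg_le_neg hy.2)
  have hs2 : √a ^ 2 = a := Real.sq_sqrt (by linarith)
  have hmul : gammaProfile a y * gammaProfile a (-y) = (1 - y ^ 2 / a) ^ (a - 1) := by
    have e : 1 - y ^ 2 / a = (1 + (√a)⁻¹ * y) * (1 + (√a)⁻¹ * -y) := by
      have : (√a)⁻¹ ^ 2 = a⁻¹ := by rw [inv_pow, hs2]
      rw [div_eq_mul_inv, ← this]; ring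
    have e2 : Real.exp (-(√a * y)) * Real.exp (-(√a * -y)) = 1 := by
      rw [← Real.exp_add, Real.exp_eq_one_iff]; ring
    rw [e, Real.mul_rpow h1 h2, gammaProfile, gammaProfile, mul_mul_mul_comm, e2, mul_one]
  have h3 := exp_le_one_sub_sq_div_rpow ha (show y ^ 2 ≤ 1 by nlinarith [hy.1, hy.2])
  rw [← hmul, two_mul (_ + _), Real.exp_add] at h3
  have p1 : 0 ≤ gammaProfile a y := by unfold gammaProfile; positivity
  have p2 : 0 ≤ gammaProfile a (-y) := by unfold gammaProfile; positivity
  refine le_of_sq_le_sq ?_ (by positivity)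
  nlinarith [sq_nonneg (gammaProfile a y - gammaProfile a (-y))]

/-- With `s = 1/√a ≤ 1/2`, the second-order expansion of `log (1 + s*y)` has error at most `2s³`.
After multiplication by `a - 1`, this error and the lower-order terms amount to at most `2s + s + s
= 4s`. -/
lemma gammaProfile_le {a y : ℝ} (ha : 4 ≤ a) (hy : y ∈ Set.Icc (-1 : ℝ) 1) :
    gammaProfile a y ≤ Real.exp (4 * (√a)⁻¹) * Real.exp (-y ^ 2 / 2) := by
  have hs2 : √a ^ 2 = a := Real.sq_sqrt (by linarith)
  have hs : 2 ≤ √a := Real.le_sqrt_of_sq_le (by linarith)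
  rw [gammaProfile]
  generalize √a = u at hs hs2
  subst hs2
  obtain ⟨s, hsu⟩ : ∃ s, s = u⁻¹ := ⟨_, rfl⟩
  have hs0 : 0 < s := by rw [hsu]; positivity
  have hus : u * s = 1 := by rw [hsu]; field_simp
  have hs1 : s ≤ 1 / 2 := by nlinarith
  rw [← hsu]
  have hya : |y| ≤ 1 := abs_le.2 hy
  have ht : |s * y| ≤ s := by
    rw [abs_mul, abs_of_pos hs0]; nlinarith
  have ht2 : |s * y| ≤ 1 / 2 := ht.trans hs1
  have hpos : 0 < 1 + s * y := by have := (abs_le.1 ht2).1; linarith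
  have hl := (abs_le.1 (Real.abs_log_sub_add_sum_range_le (x := -(s * y))
    (by rw [abs_neg]; linarith) 2)).2
  simp only [Finset.sum_range_succ, Finset.sum_range_zero, abs_neg, sub_neg_eq_add] at hl
  have hl2 : |s * y| ^ (2 + 1) / (1 - |s * y|) ≤ 2 * s ^ 3 := by
    rw [div_le_iff₀ (by linarith)]
    have : |s * y| ^ (2 + 1) ≤ s ^ 3 := pow_le_pow_left₀ (abs_nonneg _) ht 3
    nlinarith [pow_pos hs0 3]
  have hl3 : Real.log (1 + s * y) ≤ s * y - s ^ 2 * y ^ 2 / 2 + 2 * s ^ 3 := by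
    replace hl := hl.trans hl2
    norm_num at hl
    linarith [mul_pow s y 2]
  rw [Real.rpow_def_of_pos hpos, ← Real.exp_add, ← Real.exp_add, Real.exp_le_exp]
  have hu1 : 0 ≤ u ^ 2 - 1 := by nlinarith
  have h := mul_le_mul_of_nonneg_left hl3 hu1
  have e : (u ^ 2 - 1) * (s * y - s ^ 2 * y ^ 2 / 2 + 2 * s ^ 3) =
      u * y * (u * s) - (u * s) ^ 2 * y ^ 2 / 2 + 2 * s * (u * s) ^ 2
        - s * y + s ^ 2 * y ^ 2 / 2 - 2 * s ^ 3 := by ring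
  rw [e, hus] at h
  have f1 : -(s * y) ≤ s := by have := (abs_le.1 ht).1; linarith
  have f2 : s ^ 2 * y ^ 2 / 2 ≤ s := by
    have : y ^ 2 ≤ 1 := by nlinarith [hy.1, hy.2]
    nlinarith
  nlinarith [pow_pos hs0 3]

lemma gammaOneSigma_natCast_le {n : ℕ} (hn : 4 ≤ n) :
    gammaOneSigma n 1 ≤ Real.exp (4 * (√(n : ℝ))⁻¹) *
      (gaussianReal 0 1).real {x | |x| ≤ 1} := by
  have hn' : (4 : ℝ) ≤ n := by exact_mod_cast hn
  have ha : (1 : ℝ) ≤ n := by linarith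
  have hS := stirlingRemainder_natCast_nonneg (n := n) (by lia)
  have hc := continuous_gammaProfile ha
  rw [gammaOneSigma_eq_integral ha one_pos, gaussianReal_real_abs_le_one]
  have h : ∫ y in (0 : ℝ)..1, (gammaProfile n y + gammaProfile n (-y)) ≤
      Real.exp (4 * (√(n : ℝ))⁻¹) * (2 * ∫ y in (0 : ℝ)..1, Real.exp (-y ^ 2 / 2)) := by
    rw [← intervalIntegral.integral_const_mul, ← intervalIntegral.integral_const_mul]
    refine intervalIntegral.integral_mono_on zero_le_one
      (Continuous.intervalIntegrable (by fun_prop) _ _)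
      (Continuous.intervalIntegrable (by fun_prop) _ _) fun y hy => ?_
    have h1 := gammaProfile_le hn' (y := y) ⟨by linarith [hy.1], hy.2⟩
    have h2 := gammaProfile_le hn' (y := -y) ⟨by linarith [hy.2], by linarith [hy.1]⟩
    rw [neg_sq] at h2
    linarith
  have h0 : 0 ≤ ∫ y in (0 : ℝ)..1, (gammaProfile n y + gammaProfile n (-y)) := by
    refine intervalIntegral.integral_nonneg zero_le_one fun y hy => ?_
    refine le_trans (by positivity) (two_mul_exp_le_gammaProfile_add ha
      ⟨by linarith [hy.1], hy.2⟩)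
  have hE : Real.exp (-stirlingRemainder n) ≤ 1 := Real.exp_le_one_iff.2 (by linarith)
  calc _ ≤ (√(2 * Real.pi))⁻¹ * 1 * ∫ y in (0 : ℝ)..1, (gammaProfile n y + gammaProfile n (-y)) := by
        gcongr
    _ ≤ (√(2 * Real.pi))⁻¹ * 1 * _ := mul_le_mul_of_nonneg_left h (by positivity)
    _ = _ := by ring

/-! ### Numerical bounds for Gaussian integrals -/

lemma abs_integral_exp_neg_sq_div_two_sub_le :
    |(∫ y in (0 : ℝ)..1, Real.exp (-y ^ 2 / 2)) - 0.8556245| ≤ 0.0000025 := by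
  have hb : ∀ y ∈ Set.Icc (0 : ℝ) 1,
      |Real.exp (-y ^ 2 / 2) - (1 - y ^ 2 / 2 + y ^ 4 / 8 - y ^ 6 / 48 + y ^ 8 / 384
        - y ^ 10 / 3840 + y ^ 12 / 46080)| ≤ 0.0000018 := by
    intro y hy
    have hy2 : y ^ 2 ≤ 1 := by nlinarith [hy.1, hy.2]
    have hx : |-y ^ 2 / 2| ≤ 1 / 2 := by
      rw [abs_le]; constructor <;> nlinarith [sq_nonneg y]
    -- Seven Taylor terms leave an error of at most `(1/2)^7 * 8/(7! * 7) < 0.0000018`.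
    have h := Real.exp_bound (x := -y ^ 2 / 2) (by linarith) (n := 7) (by norm_num)
    have h7 : |-y ^ 2 / 2| ^ 7 ≤ (1 / 2) ^ 7 := pow_le_pow_left₀ (abs_nonneg _) hx 7
    simp only [Finset.sum_range_succ, Finset.sum_range_zero, Nat.factorial] at h
    push_cast at h
    refine le_trans (le_of_eq ?_) (h.trans ?_)
    · congr 1; ring
    · norm_num at h7 ⊢; linarith
  have hi : IntervalIntegrable (fun y : ℝ => Real.exp (-y ^ 2 / 2)) volume 0 1 :=
    Continuous.intervalIntegrable (by fun_prop) _ _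
  have hp : IntervalIntegrable (fun y : ℝ => 1 - y ^ 2 / 2 + y ^ 4 / 8 - y ^ 6 / 48 + y ^ 8 / 384
        - y ^ 10 / 3840 + y ^ 12 / 46080) volume 0 1 :=
    Continuous.intervalIntegrable (by fun_prop) _ _
  have h := intervalIntegral.norm_integral_le_of_norm_le_const (a := 0) (b := 1)
    (C := 0.0000018) (f := fun y : ℝ => Real.exp (-y ^ 2 / 2) -
      (1 - y ^ 2 / 2 + y ^ 4 / 8 - y ^ 6 / 48 + y ^ 8 / 384
        - y ^ 10 / 3840 + y ^ 12 / 46080)) (fun y hy => by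
      rw [Set.uIoc_of_le zero_le_one] at hy
      exact hb y ⟨hy.1.le, hy.2⟩)
  have hv : ∫ y in (0 : ℝ)..1, (1 - y ^ 2 / 2 + y ^ 4 / 8 - y ^ 6 / 48 + y ^ 8 / 384
        - y ^ 10 / 3840 + y ^ 12 / 46080) =
      1 - 1 / 6 + 1 / 40 - 1 / 336 + 1 / 3456 - 1 / 42240 + 1 / 599040 := by
    rw [intervalIntegral.integral_eq_sub_of_hasDerivAt (f := fun y : ℝ => y - y ^ 3 / 6
      + y ^ 5 / 40 - y ^ 7 / 336 + y ^ 9 / 3456 - y ^ 11 / 42240 + y ^ 13 / 599040) _ hp]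
    · norm_num
    · intro y _
      have := (((((((hasDerivAt_id y).sub ((hasDerivAt_pow 3 y).div_const 6)).add
        ((hasDerivAt_pow 5 y).div_const 40)).sub ((hasDerivAt_pow 7 y).div_const 336)).add
        ((hasDerivAt_pow 9 y).div_const 3456)).sub ((hasDerivAt_pow 11 y).div_const 42240)).add
        ((hasDerivAt_pow 13 y).div_const 599040))
      refine this.congr_deriv ?_
      norm_num
      ring
  rw [intervalIntegral.integral_sub hi hp, hv, Real.norm_eq_abs] at h
  rw [abs_le] at h ⊢
  norm_num at h ⊢
  constructor <;> linarith [h.1, h.2]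

lemma gaussianReal_real_abs_le_one_bounds :
    0.6826 < (gaussianReal 0 1).real {x | |x| ≤ 1} ∧
      (gaussianReal 0 1).real {x | |x| ≤ 1} < 0.6827 := by
  have h := abs_le.1 abs_integral_exp_neg_sq_div_two_sub_le
  have hp : 0 < 2 * Real.pi := by positivity
  have h1 := Real.pi_gt_d6
  have h2 := Real.pi_lt_d6
  rw [gaussianReal_real_abs_le_one, inv_mul_eq_div, lt_div_iff₀ (by positivity),
    div_lt_iff₀ (by positivity)]
  have u1 : √(2 * Real.pi) < 2.50663 := by
    rw [Real.sqrt_lt' (by norm_num)]; norm_num at *; linarith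
  have u2 : 2.50662 < √(2 * Real.pi) := by
    apply Real.lt_sqrt_of_sq_lt; norm_num at *; linarith
  norm_num at *
  constructor <;> linarith [h.1, h.2]

lemma integral_exp_neg_sq_div_two_mul_pos :
    0 < ∫ y in (0 : ℝ)..1, Real.exp (-y ^ 2 / 2) * (y ^ 2 / 2 - y ^ 4 / 4 - 1 / 12) := by
  have hi : IntervalIntegrable (fun y : ℝ => Real.exp (-y ^ 2 / 2)) volume 0 1 :=
    Continuous.intervalIntegrable (by fun_prop) _ _
  have hp : IntervalIntegrable (fun y : ℝ =>
      Real.exp (-y ^ 2 / 2) * (y ^ 2 / 2 - y ^ 4 / 4 - 1 / 12)) volume 0 1 :=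
    Continuous.intervalIntegrable (by fun_prop) _ _
  -- The factor `y/4 + y³/4` is chosen to absorb the quadratic and quartic terms. The integral
  -- becomes `exp (-1/2)/2` minus a third of the Gaussian integral, about `0.303 - 0.285`.
  have hd := intervalIntegral.integral_eq_sub_of_hasDerivAt (a := 0) (b := 1)
    (f := fun y : ℝ => Real.exp (-y ^ 2 / 2) * (y / 4 + y ^ 3 / 4))
    (f' := fun y => Real.exp (-y ^ 2 / 2) * (y ^ 2 / 2 - y ^ 4 / 4 - 1 / 12)
      + 1 / 3 * Real.exp (-y ^ 2 / 2)) (fun y _ => by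
      have h1 : HasDerivAt (fun y : ℝ => -y ^ 2 / 2) (-y) y :=
        (((hasDerivAt_pow 2 y).neg).div_const 2).congr_deriv (by norm_num; ring)
      have h2 : HasDerivAt (fun y : ℝ => y / 4 + y ^ 3 / 4) (1 / 4 + 3 * y ^ 2 / 4) y :=
        (((hasDerivAt_id y).div_const 4).add ((hasDerivAt_pow 3 y).div_const 4)).congr_deriv
          (by norm_num)
      exact (h1.exp.mul h2).congr_deriv (by ring)) (hp.add (hi.const_mul _))
  rw [intervalIntegral.integral_add hp (hi.const_mul _),
    intervalIntegral.integral_const_mul] at hd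
  have h := abs_le.1 abs_integral_exp_neg_sq_div_two_sub_le
  have he : 0.6 < Real.exp (-1 / 2) := by
    have h1 : Real.exp (-1 / 2) * Real.exp (-1 / 2) = Real.exp (-1) := by
      rw [← Real.exp_add]; norm_num
    have := Real.exp_neg_one_gt_d9
    nlinarith [Real.exp_pos (-1 / 2)]
  norm_num at hd h he ⊢
  linarith [h.1, h.2]

/-! ### Strict inequality for shape at least one -/

lemma gaussianReal_lt_gammaOneSigma_of_one_le {a b : ℝ} (ha : 1 ≤ a) (hb : 0 < b) :
    (gaussianReal 0 1).real {x | |x| ≤ 1} < gammaOneSigma a b := by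
  have ha0 : 0 < a := by linarith
  have hc := continuous_gammaProfile ha
  rw [gammaOneSigma_eq_integral ha hb, gaussianReal_real_abs_le_one, mul_assoc]
  have hpi : 0 < (√(2 * Real.pi))⁻¹ := by positivity
  refine mul_lt_mul_of_pos_left ?_ hpi
  have hi : IntervalIntegrable (fun y : ℝ => Real.exp (-y ^ 2 / 2)) volume 0 1 :=
    Continuous.intervalIntegrable (by fun_prop) _ _
  have hp : IntervalIntegrable (fun y : ℝ =>
      Real.exp (-y ^ 2 / 2) * (y ^ 2 / 2 - y ^ 4 / 4 - 1 / 12)) volume 0 1 :=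
    Continuous.intervalIntegrable (by fun_prop) _ _
  calc 2 * ∫ y in (0 : ℝ)..1, Real.exp (-y ^ 2 / 2)
      < 2 * ((∫ y in (0 : ℝ)..1, Real.exp (-y ^ 2 / 2)) + 1 / a *
          ∫ y in (0 : ℝ)..1, Real.exp (-y ^ 2 / 2) * (y ^ 2 / 2 - y ^ 4 / 4 - 1 / 12)) := by
        have := mul_pos (one_div_pos.2 ha0) integral_exp_neg_sq_div_two_mul_pos
        linarith
    _ = ∫ y in (0 : ℝ)..1, 2 * (Real.exp (-y ^ 2 / 2) + 1 / a *
          (Real.exp (-y ^ 2 / 2) * (y ^ 2 / 2 - y ^ 4 / 4 - 1 / 12))) := by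
        rw [intervalIntegral.integral_const_mul, intervalIntegral.integral_add hi (hp.const_mul _),
          intervalIntegral.integral_const_mul]
    _ ≤ ∫ y in (0 : ℝ)..1, Real.exp (-stirlingRemainder a) *
          (gammaProfile a y + gammaProfile a (-y)) := by
        refine intervalIntegral.integral_mono_on zero_le_one
          (Continuous.intervalIntegrable (by fun_prop) _ _)
          (Continuous.intervalIntegrable (by fun_prop) _ _) fun y hy => ?_
        have h1 := two_mul_exp_le_gammaProfile_add ha (y := y) ⟨by linarith [hy.1], hy.2⟩
        have h2 : Real.exp (-(1 / (12 * a))) ≤ Real.exp (-stirlingRemainder a) :=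
          Real.exp_le_exp.2 (neg_le_neg (stirlingRemainder_le ha0))
        have h3 := Real.add_one_le_exp ((y ^ 2 / 2 - y ^ 4 / 4 - 1 / 12) / a)
        calc _ = 2 * (Real.exp (-y ^ 2 / 2) *
              ((y ^ 2 / 2 - y ^ 4 / 4 - 1 / 12) / a + 1)) := by ring
          _ ≤ 2 * (Real.exp (-y ^ 2 / 2) *
              Real.exp ((y ^ 2 / 2 - y ^ 4 / 4 - 1 / 12) / a)) := by gcongr
          _ = Real.exp (-(1 / (12 * a))) *
              (2 * Real.exp (-y ^ 2 / 2 + (y ^ 2 / 2 - y ^ 4 / 4) / a)) := by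
            rw [mul_left_comm (Real.exp _) 2, ← Real.exp_add, ← Real.exp_add]
            congr 2; field_simp; ring
          _ ≤ _ := mul_le_mul h2 h1 (by positivity) (Real.exp_pos _).le
    _ = _ := intervalIntegral.integral_const_mul _ _

/-! ### Shape less than one -/

/-- Log-convexity at `2 = a*(a+1) + (1-a)*(a+2)` gives `1 ≤ (a+1)^(1-a) * Γ(a+1)`, and Bernoulli
bounds the power by `1 + a*(1-a) ≤ 5/4`. -/
lemma four_fifths_le_Gamma_add_one {a : ℝ} (ha : 0 < a) (ha1 : a < 1) :
    4 / 5 ≤ Real.Gamma (a + 1) := by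
  have h := Real.Gamma_mul_add_mul_le_rpow_Gamma_mul_rpow_Gamma (s := a + 1) (t := a + 1 + 1)
    (a := a) (b := 1 - a) (by linarith) (by linarith) ha (by linarith) (by ring)
  have hG : 0 < Real.Gamma (a + 1) := Real.Gamma_pos_of_pos (by linarith)
  rw [show a * (a + 1) + (1 - a) * (a + 1 + 1) = 2 by ring, Real.Gamma_two,
    Real.Gamma_add_one (show a + 1 ≠ 0 by linarith), Real.mul_rpow (by linarith) hG.le,
    mul_left_comm, ← Real.rpow_add hG, add_sub_cancel, Real.rpow_one] at h
  have h2 := rpow_one_add_le_one_add_mul_self (s := a) (p := 1 - a) (by linarith)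
    (by linarith) (by linarith)
  rw [add_comm 1 a] at h2
  have h3 : (a + 1) ^ (1 - a) ≤ 5 / 4 := h2.trans (by nlinarith [sq_nonneg (a - 1 / 2)])
  nlinarith

/-- The tail bound for gamma laws of shape less than one. -/
lemma gammaMeasure_real_compl_Icc_le {a r c t : ℝ} (ha : 0 < a) (ha1 : a < 1) (hr : 0 < r)
    (hc : c ≤ 0) (ht : 0 < t) :
    (gammaMeasure a r).real (Set.Icc c t)ᶜ ≤
      (r * t) ^ (a - 1) * Real.exp (-(r * t)) / Real.Gamma a := by
  have hG := Real.Gamma_pos_of_pos ha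
  have hi : IntegrableOn (fun x => r ^ a / Real.Gamma a * t ^ (a - 1) * Real.exp (-r * x))
      (Set.Ioi t) := (integrableOn_exp_mul_Ioi (neg_lt_zero.2 hr) t).const_mul _
  rw [gammaMeasure_real_apply ha hr measurableSet_Icc.compl,
    ← integral_indicator measurableSet_Icc.compl]
  calc _ ≤ ∫ x, (Set.Ioi t).indicator
        (fun x => r ^ a / Real.Gamma a * t ^ (a - 1) * Real.exp (-r * x)) x := by
        refine integral_mono_of_nonneg (ae_of_all _ fun x => Set.indicator_nonneg
          (fun x _ => gammaPDFReal_nonneg ha hr x) x)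
          (hi.integrable_indicator measurableSet_Ioi) (ae_of_all _ fun x => ?_)
        by_cases hx : t < x
        · have hx0 : 0 ≤ x := (ht.trans hx).le
          -- As `a < 1`, the power factor decreases and can be frozen at `t`, leaving an exponential
          -- tail.
          have hp : x ^ (a - 1) ≤ t ^ (a - 1) :=
            Real.rpow_le_rpow_of_nonpos ht hx.le (by linarith)
          rw [Set.indicator_of_mem (by simp [hx]), Set.indicator_of_mem (by simpa using hx),
            gammaPDFReal, if_pos hx0, neg_mul]
          gcongr
        · rw [Set.indicator_of_notMem (s := Set.Ioi t) (by simpa using hx)]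
          refine le_of_eq (Set.indicator_apply_eq_zero.2 fun hm => ?_)
          have hx0 : ¬ 0 ≤ x := fun h => hm ⟨hc.trans h, not_lt.1 hx⟩
          rw [gammaPDFReal, if_neg hx0]
    _ = _ := by
        rw [integral_indicator measurableSet_Ioi, integral_const_mul,
          integral_exp_mul_Ioi (neg_lt_zero.2 hr), Real.mul_rpow hr.le ht.le,
          Real.rpow_sub_one hr.ne', neg_mul]
        field_simp

lemma lt_gammaOneSigma_of_lt_one {a b : ℝ} (ha : 0 < a) (ha1 : a < 1) (hb : 0 < b) :
    0.6827 < gammaOneSigma a b := by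
  have hr : 0 < b⁻¹ := inv_pos.2 hb
  have := isProbabilityMeasure_gammaMeasure ha hr
  have hs : 0 < √a := Real.sqrt_pos.2 ha
  have hs2 : √a ^ 2 = a := Real.sq_sqrt ha.le
  have hs1 : √a < 1 := by nlinarith
  have h := gammaMeasure_real_compl_Icc_le (c := b * (a - √a)) (t := b * (a + √a)) ha ha1 hr
    (mul_nonpos_of_nonneg_of_nonpos hb.le (by nlinarith)) (by positivity)
  rw [probReal_compl_eq_one_sub measurableSet_Icc, inv_mul_cancel_left₀ hb.ne'] at h
  rw [gammaOneSigma]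
  -- `1 - 5/16 = 0.6875 > 0.6827`. Multiplying by `a` turns `Γ(a)` into `Γ(a+1) ≥ 4/5`, and `5/16 *
  -- 4/5 = 1/4` is the maximum of `u/(1+u)²`, met at `u = √a`.
  suffices (a + √a) ^ (a - 1) * Real.exp (-(a + √a)) / Real.Gamma a ≤ 5 / 16 by
    norm_num at *; linarith
  have hG1 := four_fifths_le_Gamma_add_one ha ha1
  have hG := Real.Gamma_pos_of_pos ha
  rw [Real.Gamma_add_one ha.ne'] at hG1
  have hτ : 0 < a + √a := by positivity
  have h1 : (a + √a) ^ a * Real.exp (-(a + √a)) ≤ 1 / (1 + √a) := by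
    have hl := mul_le_mul_of_nonneg_right (Real.log_le_sub_one_of_pos hτ) ha.le
    have he : Real.exp (-√a) ≤ 1 / (1 + √a) := by
      rw [Real.exp_neg, ← one_div]
      exact one_div_le_one_div_of_le (by positivity) (by linarith [Real.add_one_le_exp √a])
    refine le_trans ?_ he
    rw [Real.rpow_def_of_pos hτ, ← Real.exp_add, Real.exp_le_exp]
    nlinarith
  have h2 : √a / (1 + √a) ^ 2 ≤ 1 / 4 := by
    rw [div_le_div_iff₀ (by positivity) (by norm_num)]
    nlinarith [sq_nonneg (√a - 1)]
  have h3 : a * ((a + √a) ^ (a - 1) * Real.exp (-(a + √a))) ≤ 1 / 4 := by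
    refine le_trans ?_ h2
    calc _ = a / (a + √a) * ((a + √a) ^ a * Real.exp (-(a + √a))) := by
          rw [Real.rpow_sub_one hτ.ne']; ring
      _ ≤ a / (a + √a) * (1 / (1 + √a)) := by gcongr
      _ = √a / (1 + √a) ^ 2 := by
          generalize √a = u at hs hs2
          subst hs2
          field_simp
          ring
  rw [div_le_iff₀ hG]
  have h4 : a * ((a + √a) ^ (a - 1) * Real.exp (-(a + √a))) ≤ a * (5 / 16 * Real.Gamma a) := by
    linarith
  exact le_of_mul_le_mul_left h4 ha

/-! ### All shapes, and sharpness of the bound -/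

lemma gaussianReal_lt_gammaOneSigma {a b : ℝ} (ha : 0 < a) (hb : 0 < b) :
    (gaussianReal 0 1).real {x | |x| ≤ 1} < gammaOneSigma a b := by
  rcases lt_or_ge a 1 with h | h
  · exact gaussianReal_real_abs_le_one_bounds.2.trans (lt_gammaOneSigma_of_lt_one ha h hb)
  · exact gaussianReal_lt_gammaOneSigma_of_one_le h hb

/-- `X α β` is a Gamma random variable with shape `α` and scale `β`: its law is Mathlib's
`gammaMeasure` with shape `α` and rate `β⁻¹`, whose density on `x > 0` is
`x ^ (α - 1) * exp (-x / β) / (Γ(α) * β ^ α)`. Each `X α β` may live on its own space.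
`Z` is a standard normal random variable. -/
theorem theorem1p2
    {Ω : ℝ → ℝ → Type*} [∀ α β, MeasurableSpace (Ω α β)]
    (P : ∀ α β, Measure (Ω α β)) (X : ∀ α β, Ω α β → ℝ)
    (hX : ∀ α β : ℝ, 0 < α → 0 < β → HasLaw (X α β) (gammaMeasure α β⁻¹) (P α β))
    {Ω' : Type*} [MeasurableSpace Ω'] (Q : Measure Ω') (Z : Ω' → ℝ)
    (hZ : HasLaw Z (gaussianReal 0 1) Q) :
    (∀ α β : ℝ, 0 < α → 0 < β →
      Q.real {ω | |Z ω| ≤ 1} <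
        (P α β).real {ω | |X α β ω - ∫ ω', X α β ω' ∂(P α β)| ≤
          Real.sqrt (variance (X α β) (P α β))}) ∧
    ((0.6826 : ℝ) < Q.real {ω | |Z ω| ≤ 1} ∧ Q.real {ω | |Z ω| ≤ 1} < (0.6827 : ℝ)) ∧
    IsGLB {p : ℝ | ∃ α β : ℝ, 0 < α ∧ 0 < β ∧
        p = (P α β).real {ω | |X α β ω - ∫ ω', X α β ω' ∂(P α β)| ≤
          Real.sqrt (variance (X α β) (P α β))}}
      (Q.real {ω | |Z ω| ≤ 1}) := by
  have hG : ∀ α β : ℝ, 0 < α → 0 < β →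
      (P α β).real {ω | |X α β ω - ∫ ω', X α β ω' ∂(P α β)| ≤
        Real.sqrt (variance (X α β) (P α β))} = gammaOneSigma α β :=
    fun α β ha hb => (hX α β ha hb).real_abs_sub_mean_le_sqrt_variance ha hb
  have hQ : Q.real {ω | |Z ω| ≤ 1} = (gaussianReal 0 1).real {x | |x| ≤ 1} :=
    hZ.measureReal_eq (p := fun x => |x| ≤ 1)
      (measurableSet_le continuous_abs.measurable measurable_const)
  rw [hQ]
  refine ⟨fun α β ha hb => ?_, gaussianReal_real_abs_le_one_bounds, ?_, fun c hc => ?_⟩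
  · rw [hG α β ha hb]
    exact gaussianReal_lt_gammaOneSigma ha hb
  · rintro p ⟨α, β, ha, hb, rfl⟩
    rw [hG α β ha hb]
    exact (gaussianReal_lt_gammaOneSigma ha hb).le
  -- A lower bound `c` lies below `exp (4/√n)` times the Gaussian value for every `n ≥ 4`; let `n →
  -- ∞`.
  · have ht : Filter.Tendsto (fun n : ℕ => Real.exp (4 * (√(n : ℝ))⁻¹) *
        (gaussianReal 0 1).real {x | |x| ≤ 1}) Filter.atTop
        (nhds (Real.exp (4 * 0) * (gaussianReal 0 1).real {x | |x| ≤ 1})) := by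
      have h0 : Filter.Tendsto (fun n : ℕ => (√(n : ℝ))⁻¹) Filter.atTop (nhds 0) :=
        (Real.tendsto_sqrt_atTop.comp tendsto_natCast_atTop_atTop).inv_tendsto_atTop
      exact ((Real.continuous_exp.tendsto _).comp (h0.const_mul 4)).mul_const _
    rw [mul_zero, Real.exp_zero, one_mul] at ht
    refine ge_of_tendsto ht ?_
    filter_upwards [Filter.eventually_ge_atTop 4] with n hn
    have hn0 : (0 : ℝ) < n := by positivity
    exact (hc ⟨n, 1, hn0, one_pos, rfl⟩).trans
      ((hG n 1 hn0 one_pos).le.trans (gammaOneSigma_natCast_le hn))
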